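/- All sequences are real and indexed by $\mathbb{N}$. An Orlicz function is a convex, strictly increasing function $M\colon[0,\infty)\to[0,\infty)$ with $M(0)=0$. The Orlicz sequence space $\ell_M$ consists of all $x=(x_n)$ with $\sum_n M(|x_n|/\varrho)<\infty$ for some $\varrho>0$, with the Luxemburg norm $\|x\|_{\ell_M}=\inf\{\varrho>0\colon \sum_n M(|x_n|/\varrho)\leqslant 1\}$. For spaces $X,Y$ of sequences, the space of pointwise multipliers is $M(X,Y)=\{f\colon fg\in Y \text{ for all } g\in X\}$ with norm $\|f\|_{M(X,Y)}=\sup_{\|g\|_X=1}\|fg\|_Y$, and the pointwise product is $X\odot Y=\{gh\colon g\in X,\ h\in Y\}$ with quasi-norm $\|f\|_{X\odot Y}=\inf\{\|g\|_X\|h\|_Y\colon f=gh,\ g\in X,\ h\in Y\}$. Equality $X=Y$ of two such spaces means that they coincide as sets and have equivalent (quasi-)norms. **Proposition.** Define $\widetilde{M}\colon[0,\infty)\to[0,\infty)$ by $\widetilde{M}(0)=0$ and $$\widetilde{M}(t)=\begin{cases}\dfrac{2}{n!}\,t-\dfrac{1}{(n!)^2} & \text{for } \dfrac{n+2}{2(n+1)!}\leqslant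 t<\dfrac{n+1}{2\,n!},\ n\geqslant 1,\\[2mm] t^2 & \text{for } t\geqslant 1.\end{cases}$$ Then $\widetilde{M}$ is an Orlicz function, and $$\ell_{\widetilde{M}}\odot M(\ell_{\widetilde{M}},\ell_2)\neq\ell_2,\qquad\text{while}\qquad M(\ell_{\widetilde{M}},\ell_2)\neq\ell_\infty;$$ in both cases the spaces differ already as sets. Moreover, the space $M(\ell_{\widetilde{M}},\ell_2)$ is not separable. -/

import Mathlib

open scoped ENNReal NNReal Nat

/-- A space of real sequences, given by its set of elements together with its (quasi-)norm. The
norm is recorded as an extended functional on all sequences; only its values on `carrier` matter. -/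
structure SeqSpace where
  carrier : Set (ℕ → ℝ)
  nrm : (ℕ → ℝ) → ℝ≥0∞

namespace SeqSpace

/-- Equality of spaces: they coincide as sets and their (quasi-)norms are equivalent. -/
def Same (X Y : SeqSpace) : Prop :=
  X.carrier = Y.carrier ∧
    ∃ C : ℝ≥0, ∀ x ∈ X.carrier, Y.nrm x ≤ C * X.nrm x ∧ X.nrm x ≤ C * Y.nrm x

/-- Separability for the distance `‖x - y‖`: some countable subset of the space is norm dense. -/
def IsSeparable (X : SeqSpace) : Prop :=
  ∃ D : Set (ℕ → ℝ), D.Countable ∧ D ⊆ X.carrier ∧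
    ∀ x ∈ X.carrier, ∀ ε : ℝ≥0∞, 0 < ε → ∃ d ∈ D, X.nrm (x - d) < ε

/-- The space `ℓ_p`, that is, `L_p` of the natural numbers with the counting measure. -/
noncomputable def ell (p : ℝ≥0∞) : SeqSpace where
  carrier := {x | MeasureTheory.MemLp x p MeasureTheory.Measure.count}
  nrm x := MeasureTheory.eLpNorm x p MeasureTheory.Measure.count

/-- The Orlicz sequence space `ℓ_M` with the Luxemburg norm. -/
noncomputable def orlicz (M : ℝ → ℝ) : SeqSpace where
  carrier := {x | ∃ ρ : ℝ, 0 < ρ ∧ ∑' n, ENNReal.ofReal (M (|x n| / ρ)) < ∞}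
  nrm x := ⨅ (ρ : ℝ) (_ : 0 < ρ ∧ ∑' n, ENNReal.ofReal (M (|x n| / ρ)) ≤ 1), ENNReal.ofReal ρ

/-- The space `M(X, Y)` of pointwise multipliers with the operator norm. -/
noncomputable def multipliers (X Y : SeqSpace) : SeqSpace where
  carrier := {f | ∀ g ∈ X.carrier, f * g ∈ Y.carrier}
  nrm f := ⨆ (g : ℕ → ℝ) (_ : g ∈ X.carrier ∧ X.nrm g = 1), Y.nrm (f * g)

/-- The pointwise product space `E ⊙ F` with its quasi-norm. -/
noncomputable def pointwiseProduct (E F : SeqSpace) : SeqSpace where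
  carrier := {f | ∃ g ∈ E.carrier, ∃ h ∈ F.carrier, f = g * h}
  nrm f := ⨅ (g : ℕ → ℝ) (h : ℕ → ℝ) (_ : g ∈ E.carrier ∧ h ∈ F.carrier ∧ f = g * h),
    E.nrm g * F.nrm h

end SeqSpace

/-- An Orlicz function `[0, ∞) → [0, ∞)`: convex, strictly increasing and vanishing at zero
(nonnegativity follows). The values at negative arguments are irrelevant. -/
def IsOrliczFunction (M : ℝ → ℝ) : Prop :=
  ConvexOn ℝ (Set.Ici 0) M ∧ StrictMonoOn M (Set.Ici 0) ∧ M 0 = 0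

/-- `t` lies in the `n`-th interval `[(n + 2) / (2 (n + 1)!), (n + 1) / (2 n!))`, `n ≥ 1`. -/
def InPiece (n : ℕ) (t : ℝ) : Prop :=
  1 ≤ n ∧ ((n : ℝ) + 2) / (2 * (((n + 1)! : ℕ) : ℝ)) ≤ t ∧ t < ((n : ℝ) + 1) / (2 * ((n ! : ℕ) : ℝ))

open Classical in
/-- The function equal to `t ^ 2` for `t ≥ 1`, to `(2 / n!) t - 1 / (n!) ^ 2` on the `n`-th
interval of `InPiece` (these intervals partition `(0, 1)`), and to `0` at `0`. -/
noncomputable def Mtilde (t : ℝ) : ℝ :=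
  if 1 ≤ t then t ^ 2
  else if h : ∃ n, InPiece n t then
    2 / (((Nat.find h)! : ℕ) : ℝ) * t - 1 / (((Nat.find h)! : ℕ) : ℝ) ^ 2
  else 0

/-! Write a_k = 1/k!. On [0, 1) the function `Mtilde` is the upper envelope of the tangents 2 a_k t
- a_k² of t² at the points a_k. It touches t² at each a_k, but at the midpoint of a = a_(n+1) and b
= a_(n+2) its value is only ab, while t² ≥ a²/4; the ratio is at least (n+2)/4, hence unbounded.

Row j of the pairing of ℕ works at the scale N = 2^(j+1), with n = `breakIndex j` chosen so that n +
2 = N⁸, that is, a = N⁸ b. Three counts on rows give everything. A break point repeated N⁷/a² times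
costs 1/N in the modular of ℓ_M but at least N⁷/4 in ℓ_2, so no multiplier has size N⁻² on that many
places of every late row (`multiplier_not_large`); the constant 1 is therefore not a multiplier. The
value b repeated N⁷/(ab) times has square sum 1/N, giving an element of ℓ_2. If it were gh, then |g|
≥ N² b wherever |h| < N⁻², and the tangent at b makes such places too few; h would be large on at
least half of each late row. The value N⁻⁴ on 1/(ab) places of each row j in A is a multiplier for
every set A of naturals, and different sets give multipliers at distance at least 1/2. -/

/-! ### `Mtilde` as an envelope of tangents to the square. -/

/-- The reciprocal of the factorial of `n`. -/
noncomputable def invFact (n : ℕ) : ℝ := ((n ! : ℕ) : ℝ)⁻¹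

theorem invFact_pos (n : ℕ) : 0 < invFact n := by
  unfold invFact
  have := n.factorial_pos
  positivity

theorem invFact_mul_factorial (n : ℕ) : invFact n * ((n ! : ℕ) : ℝ) = 1 := by
  unfold invFact
  have := n.factorial_ne_zero
  field_simp

theorem invFact_eq_succ_mul (n : ℕ) : invFact n = (n + 1) * invFact (n + 1) := by
  unfold invFact
  have := n.factorial_ne_zero
  rw [Nat.factorial_succ]
  push_cast
  field_simp

theorem invFact_antitone {m n : ℕ} (h : m ≤ n) : invFact n ≤ invFact m := by
  unfold invFact
  have := m.factorial_pos
  gcongr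

theorem invFact_succ_lt {n : ℕ} (hn : 1 ≤ n) : invFact (n + 1) < invFact n := by
  have h := invFact_eq_succ_mul n
  have h1 : (1 : ℝ) ≤ n := by exact_mod_cast hn
  have := invFact_pos (n + 1)
  nlinarith

/-- Consecutive tangents of t² cross at the midpoint of their points of contact; the endpoints in
the definition are these midpoints. -/
theorem inPiece_succ_iff (n : ℕ) (t : ℝ) :
    InPiece (n + 1) t ↔ (invFact (n + 1) + invFact (n + 2)) / 2 ≤ t ∧
      t < (invFact n + invFact (n + 1)) / 2 := by
  have hf := n.factorial_ne_zero
  have e1 : (((n + 1 : ℕ) : ℝ) + 2) / (2 * (((n + 1 + 1)! : ℕ) : ℝ)) =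
      (invFact (n + 1) + invFact (n + 2)) / 2 := by
    unfold invFact
    rw [Nat.factorial_succ (n + 1), Nat.factorial_succ n]
    push_cast
    field_simp
    ring
  have e2 : (((n + 1 : ℕ) : ℝ) + 1) / (2 * (((n + 1)! : ℕ) : ℝ)) =
      (invFact n + invFact (n + 1)) / 2 := by
    unfold invFact
    rw [Nat.factorial_succ n]
    push_cast
    field_simp
  unfold InPiece
  rw [e1, e2]
  simp

theorem exists_inPiece {t : ℝ} (h0 : 0 < t) (h1 : t < 1) : ∃ n, InPiece n t := by
  classical
  have hex : ∃ n, (invFact (n + 1) + invFact (n + 2)) / 2 ≤ t := by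
    obtain ⟨n, hn⟩ := exists_nat_gt t⁻¹
    refine ⟨n, ?_⟩
    have hn0 : (0 : ℝ) < n := lt_trans (inv_pos.2 h0) hn
    have a1 : invFact (n + 1) ≤ (n : ℝ)⁻¹ := by
      unfold invFact
      gcongr
      exact_mod_cast n.le_succ.trans (n + 1).self_le_factorial
    have a2 := invFact_antitone (n + 1).le_succ
    have a3 : (n : ℝ)⁻¹ ≤ t := by
      rw [inv_le_comm₀ hn0 h0]; exact hn.le
    change (invFact (n + 1) + invFact (n + 1).succ) / 2 ≤ t
    linarith
  refine ⟨Nat.find hex + 1, (inPiece_succ_iff _ _).2 ⟨Nat.find_spec hex, ?_⟩⟩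
  -- For index 0 the upper endpoint is (1/0! + 1/1!)/2 = 1; otherwise minimality supplies the upper
  -- bound.
  rcases hk : Nat.find hex with _ | k
  · simpa [invFact] using h1
  · exact not_le.1 (Nat.find_min hex (m := k) (by omega))

theorem InPiece.pos {n : ℕ} {t : ℝ} (h : InPiece n t) : 0 < t := by
  refine lt_of_lt_of_le ?_ h.2.1
  have := (n + 1).factorial_pos
  positivity

theorem InPiece.lt_one {n : ℕ} {t : ℝ} (h : InPiece n t) : t < 1 := by
  obtain ⟨k, rfl⟩ : ∃ k, n = k + 1 := ⟨n - 1, by have := h.1; omega⟩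
  have h2 := ((inPiece_succ_iff k t).1 h).2
  have h3 := invFact_antitone (Nat.zero_le k)
  have h4 := invFact_antitone (Nat.zero_le (k + 1))
  have h5 : invFact 0 = 1 := by simp [invFact]
  linarith

/-- The tangents at a_n and a_k differ by (a_n - a_k)(2t - a_n - a_k), and between the two midpoints
around a_n both factors have the same sign. -/
theorem InPiece.tangent_le {n : ℕ} {t : ℝ} (h : InPiece n t) {k : ℕ} :
    2 * invFact k * t - invFact k ^ 2 ≤ 2 * invFact n * t - invFact n ^ 2 := by
  obtain ⟨n, rfl⟩ : ∃ m, n = m + 1 := ⟨n - 1, by have := h.1; omega⟩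
  obtain ⟨h1, h2⟩ := (inPiece_succ_iff n t).1 h
  rcases lt_trichotomy k (n + 1) with hk | rfl | hk
  · have a := invFact_antitone (show k ≤ n by omega)
    have b := invFact_antitone n.le_succ
    have b' : invFact (n + 1) ≤ invFact n := b
    nlinarith
  · exact le_rfl
  · have a := invFact_antitone (show n + 2 ≤ k by omega)
    have b' : invFact (n + 2) ≤ invFact (n + 1) := invFact_antitone (n + 1).le_succ
    nlinarith

theorem Mtilde_of_one_le {t : ℝ} (h : 1 ≤ t) : Mtilde t = t ^ 2 := by
  simp [Mtilde, h]

theorem InPiece.Mtilde_eq {n : ℕ} {t : ℝ} (h : InPiece n t) :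
    Mtilde t = 2 * invFact n * t - invFact n ^ 2 := by
  classical
  have hex : ∃ n, InPiece n t := ⟨n, h⟩
  have e : Mtilde t = 2 * invFact (Nat.find hex) * t - invFact (Nat.find hex) ^ 2 := by
    rw [Mtilde, if_neg (not_le.2 h.lt_one), dif_pos hex]
    simp only [invFact]
    ring
  rw [e]
  -- Two pieces containing t dominate each other there, so the index picked by `Nat.find` is
  -- immaterial.
  exact le_antisymm h.tangent_le (Nat.find_spec hex).tangent_le

theorem Mtilde_zero : Mtilde 0 = 0 := by
  have : ¬ ∃ n, InPiece n 0 := fun ⟨n, h⟩ => h.pos.ne rfl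
  rw [Mtilde, if_neg (by norm_num), dif_neg this]

theorem tangent_le_Mtilde (k : ℕ) {t : ℝ} (ht : 0 ≤ t) :
    2 * invFact k * t - invFact k ^ 2 ≤ Mtilde t := by
  rcases le_or_gt 1 t with h1 | h1
  · rw [Mtilde_of_one_le h1]
    nlinarith [sq_nonneg (t - invFact k)]
  rcases ht.eq_or_lt with rfl | h0
  · rw [Mtilde_zero]
    nlinarith [sq_nonneg (invFact k)]
  obtain ⟨n, hn⟩ := exists_inPiece h0 h1
  rw [hn.Mtilde_eq]
  exact hn.tangent_le

theorem Mtilde_pos {t : ℝ} (h0 : 0 < t) : 0 < Mtilde t := by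
  rcases le_or_gt 1 t with h1 | h1
  · rw [Mtilde_of_one_le h1]; positivity
  obtain ⟨n, hn⟩ := exists_inPiece h0 h1
  rw [hn.Mtilde_eq]
  obtain ⟨n, rfl⟩ : ∃ m, n = m + 1 := ⟨n - 1, by have := hn.1; omega⟩
  have h2 := ((inPiece_succ_iff n t).1 hn).1
  have := invFact_pos (n + 1)
  have := invFact_pos (n + 2)
  nlinarith

theorem Mtilde_nonneg {t : ℝ} (h0 : 0 ≤ t) : 0 ≤ Mtilde t := by
  rcases h0.eq_or_lt with rfl | h0
  · exact Mtilde_zero.ge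
  · exact (Mtilde_pos h0).le

/-- Supporting lines of `Mtilde`. -/
theorem exists_supporting_line {t : ℝ} (ht : 0 ≤ t) :
    ∃ c, (0 < t → 0 < c) ∧ Mtilde t = 2 * c * t - c ^ 2 ∧
      ∀ u, 0 ≤ u → 2 * c * u - c ^ 2 ≤ Mtilde u := by
  rcases le_or_gt 1 t with h1 | h1
  · refine ⟨t, id, by rw [Mtilde_of_one_le h1]; ring, fun u hu => ?_⟩
    rcases le_or_gt 1 u with h2 | h2
    · rw [Mtilde_of_one_le h2]
      nlinarith [sq_nonneg (t - u)]
    · have := tangent_le_Mtilde 0 hu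
      simp only [invFact, Nat.factorial_zero, Nat.cast_one, inv_one] at this
      nlinarith
  rcases ht.eq_or_lt with rfl | h0
  · exact ⟨0, fun h => h, by simp [Mtilde_zero], fun u hu => by simpa using Mtilde_nonneg hu⟩
  obtain ⟨n, hn⟩ := exists_inPiece h0 h1
  exact ⟨invFact n, fun _ => invFact_pos n, hn.Mtilde_eq, fun u hu => tangent_le_Mtilde n hu⟩

theorem Mtilde_strictMonoOn : StrictMonoOn Mtilde (Set.Ici 0) := by
  intro s hs t _ hst
  have hs : 0 ≤ s := hs
  rcases hs.eq_or_lt with rfl | h0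
  · rw [Mtilde_zero]; exact Mtilde_pos hst
  obtain ⟨c, hc, e, hl⟩ := exists_supporting_line hs
  have := hl t (hs.trans hst.le)
  have := hc h0
  nlinarith

theorem Mtilde_isOrliczFunction : IsOrliczFunction Mtilde := by
  refine ⟨⟨convex_Ici 0, ?_⟩, Mtilde_strictMonoOn, Mtilde_zero⟩
  intro x hx y hy a b ha hb hab
  have hx : 0 ≤ x := hx
  have hy : 0 ≤ y := hy
  simp only [smul_eq_mul]
  obtain ⟨c, -, e, hl⟩ := exists_supporting_line (t := a * x + b * y) (by positivity)
  have h1 := mul_le_mul_of_nonneg_left (hl x hx) ha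
  have h2 := mul_le_mul_of_nonneg_left (hl y hy) hb
  have h3 : c ^ 2 = a * c ^ 2 + b * c ^ 2 := by rw [← add_mul, hab, one_mul]
  rw [e]
  linarith

/-! ### Comparison of `Mtilde` with the square. -/

/-- The break point of `Mtilde` between the `n + 1`-st and the `n + 2`-nd piece. -/
noncomputable def breakPoint (n : ℕ) : ℝ := (invFact (n + 1) + invFact (n + 2)) / 2

theorem breakPoint_pos (n : ℕ) : 0 < breakPoint n := by
  have := invFact_pos (n + 1)
  have := invFact_pos (n + 2)
  unfold breakPoint
  positivity

theorem half_invFact_le_breakPoint (n : ℕ) : invFact (n + 1) / 2 ≤ breakPoint n := by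
  have := invFact_pos (n + 2)
  unfold breakPoint
  linarith

theorem Mtilde_breakPoint (n : ℕ) :
    Mtilde (breakPoint n) = invFact (n + 1) * invFact (n + 2) := by
  have h : InPiece (n + 1) (breakPoint n) := by
    rw [inPiece_succ_iff]
    refine ⟨le_rfl, ?_⟩
    have h1 : invFact (n + 2) < invFact (n + 1) := invFact_succ_lt (by omega)
    have h2 : invFact (n + 1) ≤ invFact n := invFact_antitone n.le_succ
    unfold breakPoint
    linarith
  rw [h.Mtilde_eq, breakPoint]
  ring

/-- The loss against t² on the piece around a_k is at most a factor k + 1, and t ≥ a_n only meets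
pieces with k ≤ n. -/
theorem sq_le_mul_Mtilde {n : ℕ} (hn : 1 ≤ n) {t : ℝ} (ht : invFact n ≤ t) :
    t ^ 2 ≤ (n + 1) * Mtilde t := by
  have hn' : (1 : ℝ) ≤ n := by exact_mod_cast hn
  have h0 : 0 < t := (invFact_pos n).trans_le ht
  rcases le_or_gt 1 t with h1 | h1
  · rw [Mtilde_of_one_le h1]
    nlinarith [sq_nonneg t]
  obtain ⟨k, hk⟩ := exists_inPiece h0 h1
  obtain ⟨k, rfl⟩ : ∃ m, k = m + 1 := ⟨k - 1, by have := hk.1; omega⟩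
  have hM := hk.Mtilde_eq
  obtain ⟨l, u⟩ := (inPiece_succ_iff k t).1 hk
  have e1 := invFact_eq_succ_mul k
  have e2 : invFact (k + 1) = (k + 1 + 1) * invFact (k + 2) := by
    simpa using invFact_eq_succ_mul (k + 1)
  have hkn : k + 1 ≤ n := by
    by_contra hlt
    have := invFact_antitone (show n ≤ k by omega)
    have h' : invFact (k + 1) ≤ invFact k := invFact_antitone k.le_succ
    linarith
  have hkn' : (k : ℝ) + 1 ≤ n := by exact_mod_cast hkn
  have hMk : t ^ 2 ≤ (k + 2) * Mtilde t := by
    rw [hM]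
    have hp := invFact_pos (k + 2)
    set b := invFact (k + 2)
    set a := invFact (k + 1)
    have hk0 : (0 : ℝ) ≤ k := k.cast_nonneg
    -- Left of the contact point a, `Mtilde` is at least its break value ab, and t² ≤ a² = (k+2)ab.
    -- Right of it, `Mtilde` is at least at, and t < (k+2)a/2.
    rcases le_or_gt t a with h | h
    · have : a * b ≤ 2 * a * t - a ^ 2 := by nlinarith
      nlinarith
    · rw [e1] at u
      nlinarith [mul_pos hp h0]
  have := Mtilde_pos h0
  nlinarith

/-! ### Square sums, and sums over blocks in rows of the pairing function. -/

theorem mem_ell_two_iff {x : ℕ → ℝ} :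
    x ∈ (SeqSpace.ell 2).carrier ↔ ∑' n, ENNReal.ofReal (x n ^ 2) < ∞ := by
  have hx : MeasureTheory.AEStronglyMeasurable x MeasureTheory.Measure.count :=
    (measurable_from_nat (f := x)).aestronglyMeasurable
  change MeasureTheory.MemLp x 2 MeasureTheory.Measure.count ↔ _
  rw [MeasureTheory.memLp_two_iff_integrable_sq hx, MeasureTheory.Integrable,
    and_iff_right (measurable_from_nat (f := fun n => x n ^ 2)).aestronglyMeasurable,
    MeasureTheory.hasFiniteIntegral_iff_ofReal (Filter.Eventually.of_forall fun n => sq_nonneg _),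
    MeasureTheory.lintegral_count]

theorem eLpNorm_two_count (x : ℕ → ℝ) :
    MeasureTheory.eLpNorm x 2 MeasureTheory.Measure.count =
      (∑' n, ENNReal.ofReal (x n ^ 2)) ^ (1 / 2 : ℝ) := by
  rw [MeasureTheory.eLpNorm_eq_lintegral_rpow_enorm_toReal (by norm_num) (by norm_num),
    MeasureTheory.lintegral_count]
  congr 1
  refine tsum_congr fun n => ?_
  rw [← ofReal_norm, ENNReal.ofReal_rpow_of_nonneg (norm_nonneg _) (by norm_num)]
  simp

theorem tsum_eq_tsum_fiber (F : ℕ → ℝ≥0∞) :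
    ∑' n, F n = ∑' j, ∑' n, if n.unpair.1 = j then F n else 0 := by
  rw [ENNReal.tsum_comm]
  simp

theorem tsum_eq_tsum_blocks {E : ℕ → Finset ℕ} (hE : ∀ j, ∀ n ∈ E j, n.unpair.1 = j)
    {F : ℕ → ℝ≥0∞} (hF : ∀ n, n ∉ E n.unpair.1 → F n = 0) :
    ∑' n, F n = ∑' j, ∑ n ∈ E j, F n := by
  rw [tsum_eq_tsum_fiber]
  refine tsum_congr fun j => ?_
  rw [tsum_eq_sum (s := E j)]
  · refine Finset.sum_congr rfl fun n hn => ?_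
    rw [if_pos (hE j n hn)]
  · intro n hn
    split_ifs with h
    · exact hF n (by rwa [h])
    · rfl

/-- The sequence with the value `v j` on the `j`-th of the blocks `E j`. -/
def blockSeq (E : ℕ → Finset ℕ) (v : ℕ → ℝ) (n : ℕ) : ℝ :=
  if n ∈ E n.unpair.1 then v n.unpair.1 else 0

theorem blockSeq_of_mem {E : ℕ → Finset ℕ} (hE : ∀ j, ∀ n ∈ E j, n.unpair.1 = j) (v : ℕ → ℝ)
    {j n : ℕ} (hn : n ∈ E j) : blockSeq E v n = v j := by
  have := hE j n hn
  rw [blockSeq, this, if_pos hn]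

/-- `k` natural numbers in the `j`-th row of the pairing function. -/
def rowBlock (j k : ℕ) : Finset ℕ := (Finset.range k).image (Nat.pair j)

theorem card_rowBlock (j k : ℕ) : (rowBlock j k).card = k := by
  rw [rowBlock, Finset.card_image_of_injective, Finset.card_range]
  intro a b h
  simpa using h

theorem unpair_of_mem_rowBlock {j k n : ℕ} (h : n ∈ rowBlock j k) : n.unpair.1 = j := by
  simp only [rowBlock, Finset.mem_image] at h
  obtain ⟨i, -, rfl⟩ := h
  simp

/-! ### The scales, and multipliers that are too large. -/

/-- The index of the break point used on the `j`-th block. -/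
def breakIndex (j : ℕ) : ℕ := 2 ^ (8 * (j + 1)) - 2

theorem breakIndex_add_two (j : ℕ) : breakIndex j + 2 = (2 ^ (j + 1)) ^ 8 := by
  have : 2 ^ 1 ≤ 2 ^ (8 * (j + 1)) := Nat.pow_le_pow_right (by norm_num) (by omega)
  rw [← pow_mul, mul_comm (j + 1) 8, breakIndex]
  omega

theorem invFact_breakIndex (j : ℕ) :
    invFact (breakIndex j + 1) = (2 ^ (j + 1)) ^ 8 * invFact (breakIndex j + 2) := by
  have h := invFact_eq_succ_mul (breakIndex j + 1)
  have h2 : ((breakIndex j + 1 : ℕ) : ℝ) + 1 = (2 ^ (j + 1)) ^ 8 := by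
    have := breakIndex_add_two j
    exact_mod_cast this
  rw [h2] at h
  exact h

theorem tsum_inv_two_pow_lt_top : ∑' j : ℕ, ENNReal.ofReal ((2 ^ (j + 1))⁻¹) < ∞ := by
  have : Summable fun j : ℕ => ((2 : ℝ) ^ (j + 1))⁻¹ := by
    have := (summable_nat_add_iff 1).2 (summable_geometric_two)
    simpa using this
  exact this.tsum_ofReal_lt_top

theorem sum_ofReal_const (E : Finset ℕ) (y : ℝ) :
    ∑ _n ∈ E, ENNReal.ofReal y = ENNReal.ofReal (E.card * y) := by
  rw [Finset.sum_const, nsmul_eq_mul, ENNReal.ofReal_mul (by positivity), ENNReal.ofReal_natCast]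

/-- A multiplier cannot be bounded below by `4 ^ (-j - 1)` on a large part of every row. -/
theorem multiplier_not_large {h : ℕ → ℝ}
    (hm : h ∈ (SeqSpace.multipliers (SeqSpace.orlicz Mtilde) (SeqSpace.ell 2)).carrier) (J : ℕ)
    (H : ∀ j, J ≤ j → ∃ E : Finset ℕ, (∀ n ∈ E, n.unpair.1 = j) ∧
      (breakIndex j + 1)! ^ 2 * (2 ^ (j + 1)) ^ 7 ≤ E.card ∧
      ∀ n ∈ E, ((2 ^ (j + 1)) ^ 2)⁻¹ ≤ |h n|) : False := by
  -- Blocks are trimmed to the exact size: the upper bound keeps the test sequence in ℓ_M, the lower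
  -- bound makes its product with h leave ℓ_2.
  have H' : ∀ j, ∃ E : Finset ℕ, (∀ n ∈ E, n.unpair.1 = j) ∧
      (E.card ≤ (breakIndex j + 1)! ^ 2 * (2 ^ (j + 1)) ^ 7) ∧
      (J ≤ j → E.card = (breakIndex j + 1)! ^ 2 * (2 ^ (j + 1)) ^ 7) ∧
      ∀ n ∈ E, ((2 ^ (j + 1)) ^ 2)⁻¹ ≤ |h n| := by
    intro j
    by_cases hj : J ≤ j
    · obtain ⟨E, h1, h2, h3⟩ := H j hj
      obtain ⟨E', hs, hc⟩ := Finset.exists_subset_card_eq h2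
      exact ⟨E', fun n hn => h1 n (hs hn), hc.le, fun _ => hc, fun n hn => h3 n (hs hn)⟩
    · exact ⟨∅, by simp, by simp, fun h => absurd h hj, by simp⟩
  choose E hE hle hcard hlow using H'
  set v : ℕ → ℝ := fun j => breakPoint (breakIndex j) with hv
  have hg : blockSeq E v ∈ (SeqSpace.orlicz Mtilde).carrier := by
    refine ⟨1, one_pos, ?_⟩
    rw [tsum_eq_tsum_blocks hE]
    · refine lt_of_le_of_lt (ENNReal.tsum_le_tsum fun j => ?_) tsum_inv_two_pow_lt_top
      have hsum : ∑ n ∈ E j, ENNReal.ofReal (Mtilde (|blockSeq E v n| / 1)) =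
          ∑ n ∈ E j, ENNReal.ofReal (invFact (breakIndex j + 1) * invFact (breakIndex j + 2)) := by
        refine Finset.sum_congr rfl fun n hn => ?_
        rw [blockSeq_of_mem hE v hn, div_one, abs_of_pos (breakPoint_pos _), Mtilde_breakPoint]
      have hA := invFact_pos (breakIndex j + 1)
      have hB := invFact_pos (breakIndex j + 2)
      rw [hsum, sum_ofReal_const]
      refine ENNReal.ofReal_le_ofReal ?_
      have hc : ((E j).card : ℝ) ≤
          (((breakIndex j + 1)! : ℕ) : ℝ) ^ 2 * (2 ^ (j + 1)) ^ 7 := by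
        exact_mod_cast hle j
      refine (mul_le_mul_of_nonneg_right hc (by positivity)).trans_eq ?_
      have e := invFact_breakIndex j
      have f := invFact_mul_factorial (breakIndex j + 1)
      have hN : (0 : ℝ) < 2 ^ (j + 1) := by positivity
      generalize (2 : ℝ) ^ (j + 1) = N at *
      generalize invFact (breakIndex j + 2) = B at *
      generalize invFact (breakIndex j + 1) = A at *
      generalize (((breakIndex j + 1)! : ℕ) : ℝ) = F at *
      refine eq_inv_of_mul_eq_one_left ?_
      calc F ^ 2 * N ^ 7 * (A * B) * N = F * (A * F) * (N ^ 8 * B) := by ring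
        _ = 1 := by rw [← e, f, mul_one, mul_comm, f]
    · intro n hn
      simp [blockSeq, hn, Mtilde_zero]
  have hfg := mem_ell_two_iff.1 (hm _ hg)
  rw [tsum_eq_tsum_blocks hE] at hfg
  swap
  · intro n hn
    simp [blockSeq, hn]
  refine hfg.ne (top_unique ?_)
  have htop : ∑' j : ℕ, (1 : ℝ≥0∞) = ∞ := ENNReal.tsum_const_eq_top_of_ne_zero one_ne_zero
  have hshift := ENNReal.tsum_comp_le_tsum_of_injective (add_left_injective J)
    (fun j => ∑ n ∈ E j, ENNReal.ofReal ((h * blockSeq E v) n ^ 2))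
  -- Each row from J on contributes at least N³/4 ≥ 1 to the square sum.
  refine le_trans (htop.ge.trans (ENNReal.tsum_le_tsum fun i => ?_)) hshift
  set j := i + J with hj
  have hcj : ((E j).card : ℝ) = (((breakIndex j + 1)! : ℕ) : ℝ) ^ 2 * (2 ^ (j + 1)) ^ 7 := by
    exact_mod_cast hcard j (by omega)
  have hA := invFact_pos (breakIndex j + 1)
  have hsum : ∑ n ∈ E j,
      ENNReal.ofReal ((((2 ^ (j + 1)) ^ 2)⁻¹ * (invFact (breakIndex j + 1) / 2)) ^ 2) ≤
      ∑ n ∈ E j, ENNReal.ofReal ((h * blockSeq E v) n ^ 2) := by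
    refine Finset.sum_le_sum fun n hn => ENNReal.ofReal_le_ofReal ?_
    rw [Pi.mul_apply, blockSeq_of_mem hE v hn, ← sq_abs (h n * v j), abs_mul,
      abs_of_pos (breakPoint_pos _)]
    have h1 := hlow j n hn
    have h2 := half_invFact_le_breakPoint (breakIndex j)
    gcongr
  refine le_trans ?_ hsum
  rw [sum_ofReal_const, ← ENNReal.ofReal_one, hcj]
  refine ENNReal.ofReal_le_ofReal ?_
  have f := invFact_mul_factorial (breakIndex j + 1)
  have hN : (2 : ℝ) ≤ 2 ^ (j + 1) := by
    have : (1 : ℝ) ≤ 2 ^ j := one_le_pow₀ (by norm_num)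
    rw [pow_succ]; linarith
  generalize (2 : ℝ) ^ (j + 1) = N at *
  generalize invFact (breakIndex j + 1) = A at *
  generalize (((breakIndex j + 1)! : ℕ) : ℝ) = F at *
  have hN0 : N ≠ 0 := by positivity
  calc (1 : ℝ) ≤ 2 ^ 3 / 4 := by norm_num
    _ ≤ N ^ 3 / 4 := by gcongr
    _ = (A * F) ^ 2 * (N ^ 3 / 4) := by rw [f]; ring
    _ = _ := by field_simp; norm_num

theorem multipliers_ne_ell_top :
    (SeqSpace.multipliers (SeqSpace.orlicz Mtilde) (SeqSpace.ell 2)).carrier ≠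
      (SeqSpace.ell ⊤).carrier := by
  intro h
  have h1 : (fun _ => 1 : ℕ → ℝ) ∈ (SeqSpace.ell ⊤).carrier :=
    MeasureTheory.memLp_top_const 1
  rw [← h] at h1
  refine multiplier_not_large h1 0 fun j _ => ⟨_, fun n hn => unpair_of_mem_rowBlock hn,
    (card_rowBlock j _).ge, fun n _ => ?_⟩
  rw [abs_one]
  refine inv_le_one_of_one_le₀ ?_
  exact one_le_pow₀ (one_le_pow₀ (by norm_num))

/-! ### An element of ℓ_2 that does not factor. -/

theorem factorial_breakIndex (j : ℕ) : (((breakIndex j + 2)! : ℕ) : ℝ) =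
    (2 ^ (j + 1)) ^ 8 * (((breakIndex j + 1)! : ℕ) : ℝ) := by
  have h := breakIndex_add_two j
  rw [Nat.factorial_succ (breakIndex j + 1), show breakIndex j + 1 + 1 = breakIndex j + 2 from rfl,
    h]
  push_cast
  ring

/-- The rows on which a sequence of `ℓ_2` that does not factor is supported. -/
def wideRow (j : ℕ) : Finset ℕ :=
  rowBlock j ((breakIndex j + 1)! * (breakIndex j + 2)! * (2 ^ (j + 1)) ^ 7)

theorem card_wideRow (j : ℕ) : ((wideRow j).card : ℝ) =
    (((breakIndex j + 1)! : ℕ) : ℝ) * (((breakIndex j + 2)! : ℕ) : ℝ) * (2 ^ (j + 1)) ^ 7 := by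
  rw [wideRow, card_rowBlock]
  push_cast
  ring

theorem unpair_of_mem_wideRow (j n : ℕ) (h : n ∈ wideRow j) : n.unpair.1 = j :=
  unpair_of_mem_rowBlock h

/-- A sequence of `ℓ_2` which is not in `ℓ_M ⊙ M(ℓ_M, ℓ_2)` for `M = Mtilde`. -/
noncomputable def wideSeq : ℕ → ℝ := blockSeq wideRow fun j => invFact (breakIndex j + 2)

theorem wideSeq_mem_ell_two : wideSeq ∈ (SeqSpace.ell 2).carrier := by
  rw [mem_ell_two_iff, tsum_eq_tsum_blocks unpair_of_mem_wideRow]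
  · refine lt_of_le_of_lt (ENNReal.tsum_le_tsum fun j => ?_) tsum_inv_two_pow_lt_top
    have hsum : ∑ n ∈ wideRow j, ENNReal.ofReal (wideSeq n ^ 2) =
        ∑ n ∈ wideRow j, ENNReal.ofReal (invFact (breakIndex j + 2) ^ 2) :=
      Finset.sum_congr rfl fun n hn => by
        rw [wideSeq, blockSeq_of_mem unpair_of_mem_wideRow _ hn]
    rw [hsum, sum_ofReal_const, card_wideRow]
    refine ENNReal.ofReal_le_ofReal (le_of_eq ?_)
    have e := factorial_breakIndex j
    have f := invFact_mul_factorial (breakIndex j + 2)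
    have hN : (0 : ℝ) < 2 ^ (j + 1) := by positivity
    generalize (2 : ℝ) ^ (j + 1) = N at *
    generalize invFact (breakIndex j + 2) = B at *
    generalize (((breakIndex j + 1)! : ℕ) : ℝ) = F at *
    generalize (((breakIndex j + 2)! : ℕ) : ℝ) = G at *
    refine eq_inv_of_mul_eq_one_left ?_
    calc F * G * N ^ 7 * B ^ 2 * N = (B * (N ^ 8 * F)) * (B * G) := by ring
      _ = 1 := by rw [← e, f, mul_one]
  · intro n hn
    simp [wideSeq, blockSeq, hn]

/-- Markov's inequality for the counting measure. -/
theorem card_mul_le_of_tsum_lt_top {u : ℕ → ℝ} {C : Finset ℕ} {b : ℝ}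
    (hu : ∑' n, ENNReal.ofReal (u n) < ∞) (hb : 0 ≤ b) (hC : ∀ n ∈ C, b ≤ u n) :
    C.card * b ≤ (∑' n, ENNReal.ofReal (u n)).toReal := by
  have h1 : ENNReal.ofReal (C.card * b) ≤ ∑' n, ENNReal.ofReal (u n) := by
    rw [← sum_ofReal_const]
    exact (Finset.sum_le_sum fun n hn => ENNReal.ofReal_le_ofReal (hC n hn)).trans
      (ENNReal.sum_le_tsum C)
  rw [← ENNReal.toReal_ofReal (show 0 ≤ C.card * b by positivity)]
  exact ENNReal.toReal_mono hu.ne h1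

theorem wideSeq_notMem_pointwiseProduct :
    wideSeq ∉ (SeqSpace.pointwiseProduct (SeqSpace.orlicz Mtilde)
      (SeqSpace.multipliers (SeqSpace.orlicz Mtilde) (SeqSpace.ell 2))).carrier := by
  rintro ⟨g, ⟨ρ, hρ, hg⟩, h, hh, hf⟩
  set Q : ℝ := (∑' n, ENNReal.ofReal (Mtilde (|g n| / ρ))).toReal with hQ
  -- From row J on, N ≥ ρ lets the linear term of the tangent absorb its constant, and N ≥ 2Qρ
  -- leaves at most half of the row to the places where h is small.
  obtain ⟨J, hJ⟩ := exists_nat_ge (max ρ (2 * Q * ρ))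
  refine multiplier_not_large hh J fun j hj =>
    ⟨(wideRow j).filter fun n => ((2 ^ (j + 1)) ^ 2)⁻¹ ≤ |h n|,
      fun n hn => unpair_of_mem_wideRow j n (Finset.mem_filter.1 hn).1, ?_,
      fun n hn => (Finset.mem_filter.1 hn).2⟩
  have hJN : (J : ℝ) ≤ 2 ^ (j + 1) := by
    have : J ≤ 2 ^ (j + 1) := (hj.trans j.le_succ).trans Nat.lt_two_pow_self.le
    exact_mod_cast this
  have hsplit := Finset.card_filter_add_card_filter_not (s := wideRow j)
    (fun n => ((2 ^ (j + 1)) ^ 2)⁻¹ ≤ |h n|)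
  have hsplit' := congrArg (Nat.cast : ℕ → ℝ) hsplit
  rw [Nat.cast_add, card_wideRow] at hsplit'
  have hB := invFact_pos (breakIndex j + 2)
  have hρN := (le_max_left _ _).trans (hJ.trans hJN)
  have hQN := (le_max_right _ _).trans (hJ.trans hJN)
  have hN : (2 : ℝ) ≤ 2 ^ (j + 1) := by
    have : (1 : ℝ) ≤ 2 ^ j := one_le_pow₀ (by norm_num)
    rw [pow_succ]; linarith
  -- Where |h| < N⁻², |g| ≥ bN², so the tangent at b gives at least 2b²N²/ρ - b² ≥ b²N²/ρ.
  have hcompl := card_mul_le_of_tsum_lt_top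
    (C := (wideRow j).filter fun n => ¬ ((2 ^ (j + 1)) ^ 2)⁻¹ ≤ |h n|)
    (b := invFact (breakIndex j + 2) ^ 2 * (2 ^ (j + 1)) ^ 2 / ρ) hg (by positivity) (by
      intro n hn
      obtain ⟨hn1, hn2⟩ := Finset.mem_filter.1 hn
      have hfn : invFact (breakIndex j + 2) = |g n| * |h n| := by
        have := congrFun hf n
        rw [wideSeq, blockSeq_of_mem unpair_of_mem_wideRow _ hn1, Pi.mul_apply] at this
        rw [← abs_mul, ← this, abs_of_pos hB]
      have ht := tangent_le_Mtilde (breakIndex j + 2) (t := |g n| / ρ) (by positivity)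
      refine le_trans ?_ ht
      have hgn : invFact (breakIndex j + 2) * (2 ^ (j + 1)) ^ 2 ≤ |g n| := by
        rw [hfn, mul_assoc]
        refine mul_le_of_le_one_right (abs_nonneg _) ?_
        rw [← le_div_iff₀ (by positivity), one_div]
        exact (not_le.1 hn2).le
      generalize (2 : ℝ) ^ (j + 1) = N at *
      generalize invFact (breakIndex j + 2) = B at *
      have h1 : B * N ^ 2 / ρ ≤ |g n| / ρ := by gcongr
      have h2 : 1 ≤ N ^ 2 / ρ := by
        rw [le_div_iff₀ hρ]; nlinarith
      calc B ^ 2 * N ^ 2 / ρ = 2 * B * (B * N ^ 2 / ρ) - B ^ 2 * (N ^ 2 / ρ) := by ring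
        _ ≤ 2 * B * (|g n| / ρ) - B ^ 2 * 1 := by gcongr
        _ = _ := by ring)
  rw [← hQ] at hcompl
  have key : (((breakIndex j + 1)! : ℕ) : ℝ) ^ 2 * (2 ^ (j + 1)) ^ 7 ≤
      (((wideRow j).filter fun n => ((2 ^ (j + 1)) ^ 2)⁻¹ ≤ |h n|).card : ℝ) := by
    have e := factorial_breakIndex j
    have f := invFact_mul_factorial (breakIndex j + 2)
    have hF : (0 : ℝ) < (((breakIndex j + 1)! : ℕ) : ℝ) := by
      exact_mod_cast (breakIndex j + 1).factorial_pos
    generalize ((((wideRow j).filter fun n => ¬ ((2 ^ (j + 1)) ^ 2)⁻¹ ≤ |h n|).card : ℕ) : ℝ) = c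
      at *
    generalize ((((wideRow j).filter fun n => ((2 ^ (j + 1)) ^ 2)⁻¹ ≤ |h n|).card : ℕ) : ℝ) = d
      at *
    generalize (2 : ℝ) ^ (j + 1) = N at *
    generalize invFact (breakIndex j + 2) = B at *
    generalize (((breakIndex j + 1)! : ℕ) : ℝ) = F at *
    generalize (((breakIndex j + 2)! : ℕ) : ℝ) = G at *
    have hN0 : 0 < N := by linarith
    have h1 : c * N ^ 2 ≤ Q * ρ * G ^ 2 := by
      have h2 : c * (B ^ 2 * N ^ 2) ≤ Q * ρ := by
        rwa [← mul_div_assoc, div_le_iff₀ hρ] at hcompl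
      calc c * N ^ 2 = c * (B ^ 2 * N ^ 2) * G ^ 2 := by
            rw [show c * (B ^ 2 * N ^ 2) * G ^ 2 = c * N ^ 2 * (B * G) ^ 2 by ring, f]; ring
        _ ≤ _ := by gcongr
    have h2 : c ≤ N ^ 15 * F ^ 2 / 2 := by
      have h3 : Q * ρ * G ^ 2 ≤ N / 2 * G ^ 2 := by
        gcongr
        linarith
      have h4 : c * N ^ 2 ≤ N ^ 15 * F ^ 2 / 2 * N ^ 2 := by
        refine (h1.trans h3).trans_eq ?_
        rw [e]; ring
      exact le_of_mul_le_mul_right h4 (by positivity)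
    have h5 : 2 ≤ N ^ 8 := hN.trans (le_self_pow₀ (by linarith) (by norm_num))
    have h6 : F ^ 2 * N ^ 7 * 2 ≤ F ^ 2 * N ^ 7 * N ^ 8 := by gcongr
    rw [e] at hsplit'
    nlinarith
  exact_mod_cast key

/-! ### An uncountable separated family of multipliers. -/

open Classical in
/-- The part with index in `A` of a fixed sequence of blocks. -/
noncomputable def selectedRow (A : Set ℕ) (j : ℕ) : Finset ℕ :=
  if j ∈ A then rowBlock j ((breakIndex j + 1)! * (breakIndex j + 2)!) else ∅

theorem unpair_of_mem_selectedRow (A : Set ℕ) (j n : ℕ) (h : n ∈ selectedRow A j) :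
    n.unpair.1 = j := by
  unfold selectedRow at h
  split_ifs at h
  · exact unpair_of_mem_rowBlock h
  · simp at h

theorem card_selectedRow_le (A : Set ℕ) (j : ℕ) : ((selectedRow A j).card : ℝ) ≤
    (((breakIndex j + 1)! : ℕ) : ℝ) * (((breakIndex j + 2)! : ℕ) : ℝ) := by
  unfold selectedRow
  split_ifs
  · rw [card_rowBlock]; push_cast; exact le_rfl
  · simp only [Finset.card_empty, Nat.cast_zero]; positivity

/-- A family of multipliers, indexed by the sets of natural numbers, which is uniformly
separated. -/
noncomputable def selectedSeq (A : Set ℕ) : ℕ → ℝ :=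
  blockSeq (selectedRow A) fun j => ((2 ^ (j + 1)) ^ 4)⁻¹

theorem selectedSeq_mem_multipliers (A : Set ℕ) : selectedSeq A ∈
    (SeqSpace.multipliers (SeqSpace.orlicz Mtilde) (SeqSpace.ell 2)).carrier := by
  rintro g ⟨ρ, hρ, hg⟩
  rw [mem_ell_two_iff]
  set w : ℕ → ℝ := blockSeq (selectedRow A)
    fun j => ((2 ^ (j + 1)) ^ 4)⁻¹ * invFact (breakIndex j + 2) with hw
  -- Places with |g|/ρ ≤ b are charged to the square-summable w, the others to the modular of g.
  have hpt : ∀ n, ENNReal.ofReal ((selectedSeq A * g) n ^ 2) ≤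
      ENNReal.ofReal (ρ ^ 2) * ENNReal.ofReal (w n ^ 2) +
        ENNReal.ofReal (2 * ρ ^ 2) * ENNReal.ofReal (Mtilde (|g n| / ρ)) := by
    intro n
    have ht : 0 ≤ |g n| / ρ := by positivity
    have hM := Mtilde_nonneg ht
    rw [← ENNReal.ofReal_mul (by positivity), ← ENNReal.ofReal_mul (by positivity),
      ← ENNReal.ofReal_add (by positivity) (by positivity)]
    refine ENNReal.ofReal_le_ofReal ?_
    by_cases hn : n ∈ selectedRow A n.unpair.1
    · rw [hw, Pi.mul_apply, selectedSeq, blockSeq, blockSeq, if_pos hn, if_pos hn]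
      have hgn : g n ^ 2 = ρ ^ 2 * (|g n| / ρ) ^ 2 := by
        rw [div_pow, sq_abs]; field_simp
      -- With n + 2 = N⁸, the loss above b is N⁸ + 1 ≤ 2N⁸, which the squared weight N⁻⁸ cancels up
      -- to the factor 2.
      have hb : ((breakIndex n.unpair.1 + 2 : ℕ) : ℝ) = (2 ^ (n.unpair.1 + 1)) ^ 8 := by
        exact_mod_cast breakIndex_add_two n.unpair.1
      have hsq := sq_le_mul_Mtilde (n := breakIndex n.unpair.1 + 2) (by omega) (t := |g n| / ρ)
      rw [hb] at hsq
      rw [mul_pow, hgn]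
      have hN : (1 : ℝ) ≤ 2 ^ (n.unpair.1 + 1) := one_le_pow₀ (by norm_num)
      have hB := invFact_pos (breakIndex n.unpair.1 + 2)
      generalize (2 : ℝ) ^ (n.unpair.1 + 1) = N at *
      generalize invFact (breakIndex n.unpair.1 + 2) = B at *
      generalize Mtilde (|g n| / ρ) = m at *
      generalize |g n| / ρ = t at *
      have hN0 : N ≠ 0 := by positivity
      rcases le_total B t with h | h
      · have h1 : (N ^ 4)⁻¹ ^ 2 * t ^ 2 ≤ 2 * m := by
          have h2 : N ^ 8 + 1 ≤ 2 * N ^ 8 := by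
            have : 1 ≤ N ^ 8 := one_le_pow₀ hN
            linarith
          have h3 : t ^ 2 ≤ 2 * N ^ 8 * m := (hsq h).trans (by gcongr)
          calc (N ^ 4)⁻¹ ^ 2 * t ^ 2 ≤ (N ^ 4)⁻¹ ^ 2 * (2 * N ^ 8 * m) := by gcongr
            _ = 2 * m := by field_simp
        have h4 : 0 ≤ ρ ^ 2 * ((N ^ 4)⁻¹ * B) ^ 2 := by positivity
        nlinarith [mul_le_mul_of_nonneg_left h1 (sq_nonneg ρ)]
      · have h1 : (N ^ 4)⁻¹ ^ 2 * (ρ ^ 2 * t ^ 2) ≤ (N ^ 4)⁻¹ ^ 2 * (ρ ^ 2 * B ^ 2) := by gcongr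
        have h2 : 0 ≤ 2 * ρ ^ 2 * m := by positivity
        nlinarith
    · rw [Pi.mul_apply, selectedSeq, blockSeq, if_neg hn, zero_mul, zero_pow two_ne_zero]
      positivity
  refine lt_of_le_of_lt (ENNReal.tsum_le_tsum hpt) ?_
  rw [ENNReal.tsum_add, ENNReal.tsum_mul_left, ENNReal.tsum_mul_left]
  refine ENNReal.add_lt_top.2 ⟨ENNReal.mul_lt_top ENNReal.ofReal_lt_top ?_,
    ENNReal.mul_lt_top ENNReal.ofReal_lt_top hg⟩
  rw [tsum_eq_tsum_blocks (unpair_of_mem_selectedRow A)]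
  · refine lt_of_le_of_lt (ENNReal.tsum_le_tsum fun j => ?_) tsum_inv_two_pow_lt_top
    have hsum : ∑ n ∈ selectedRow A j, ENNReal.ofReal (w n ^ 2) = ∑ n ∈ selectedRow A j,
        ENNReal.ofReal ((((2 ^ (j + 1)) ^ 4)⁻¹ * invFact (breakIndex j + 2)) ^ 2) :=
      Finset.sum_congr rfl fun n hn => by
        rw [hw, blockSeq_of_mem (unpair_of_mem_selectedRow A) _ hn]
    rw [hsum, sum_ofReal_const]
    refine ENNReal.ofReal_le_ofReal ?_
    refine (mul_le_mul_of_nonneg_right (card_selectedRow_le A j) (sq_nonneg _)).trans ?_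
    have e := factorial_breakIndex j
    have f := invFact_mul_factorial (breakIndex j + 2)
    have hN : (1 : ℝ) ≤ 2 ^ (j + 1) := one_le_pow₀ (by norm_num)
    generalize (2 : ℝ) ^ (j + 1) = N at *
    generalize invFact (breakIndex j + 2) = B at *
    generalize (((breakIndex j + 1)! : ℕ) : ℝ) = F at *
    generalize (((breakIndex j + 2)! : ℕ) : ℝ) = G at *
    have hN0 : N ≠ 0 := by positivity
    have h1 : F * G * ((N ^ 4)⁻¹ * B) ^ 2 = (N ^ 16)⁻¹ := by
      calc F * G * ((N ^ 4)⁻¹ * B) ^ 2 = (N ^ 16)⁻¹ * (B * (N ^ 8 * F)) * (B * G) := by field_simp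
        _ = _ := by rw [← e, f]; ring
    rw [h1]
    gcongr
    exact le_self_pow₀ hN (by norm_num)
  · intro n hn
    simp [hw, blockSeq, hn]

/-- A normalised element of the Orlicz space which tests the `j`-th block. -/
noncomputable def testSeq (j n : ℕ) : ℝ :=
  if n ∈ rowBlock j ((breakIndex j + 1)! * (breakIndex j + 2)!) then breakPoint (breakIndex j)
  else 0

theorem tsum_Mtilde_testSeq (j : ℕ) (ρ : ℝ) :
    ∑' n, ENNReal.ofReal (Mtilde (|testSeq j n| / ρ)) =
      ENNReal.ofReal ((((breakIndex j + 1)! : ℕ) : ℝ) * (((breakIndex j + 2)! : ℕ) : ℝ) *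
        Mtilde (breakPoint (breakIndex j) / ρ)) := by
  rw [tsum_eq_sum (s := rowBlock j ((breakIndex j + 1)! * (breakIndex j + 2)!))]
  · have hsum := Finset.sum_congr (f := fun n => ENNReal.ofReal (Mtilde (|testSeq j n| / ρ)))
      (rfl : rowBlock j ((breakIndex j + 1)! * (breakIndex j + 2)!) = _)
      (g := fun _ => ENNReal.ofReal (Mtilde (breakPoint (breakIndex j) / ρ)))
      fun n hn => by simp only [testSeq, if_pos hn, abs_of_pos (breakPoint_pos _)]
    rw [hsum, sum_ofReal_const, card_rowBlock]
    push_cast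
    rfl
  · intro n hn
    simp [testSeq, hn, Mtilde_zero]

theorem factorial_mul_Mtilde_breakPoint (n : ℕ) :
    (((n + 1)! : ℕ) : ℝ) * (((n + 2)! : ℕ) : ℝ) * Mtilde (breakPoint n) = 1 := by
  rw [Mtilde_breakPoint]
  calc _ = (invFact (n + 1) * (((n + 1)! : ℕ) : ℝ)) * (invFact (n + 2) * (((n + 2)! : ℕ) : ℝ)) := by
        ring
    _ = 1 := by rw [invFact_mul_factorial, invFact_mul_factorial, mul_one]

theorem testSeq_mem_orlicz (j : ℕ) : testSeq j ∈ (SeqSpace.orlicz Mtilde).carrier :=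
  ⟨1, one_pos, by rw [tsum_Mtilde_testSeq j 1]; exact ENNReal.ofReal_lt_top⟩

theorem nrm_testSeq (j : ℕ) : (SeqSpace.orlicz Mtilde).nrm (testSeq j) = 1 := by
  have h1 := factorial_mul_Mtilde_breakPoint (breakIndex j)
  refine le_antisymm ?_ (le_iInf₂ fun ρ hρ => ?_)
  · refine (iInf₂_le 1 ⟨one_pos, ?_⟩).trans ENNReal.ofReal_one.le
    rw [tsum_Mtilde_testSeq j 1, div_one, h1, ENNReal.ofReal_one]
  · obtain ⟨hρ0, hρ⟩ := hρ
    rw [tsum_Mtilde_testSeq j ρ, ENNReal.ofReal_le_one, ← h1] at hρ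
    rw [ENNReal.one_le_ofReal]
    by_contra! hlt
    have hp := breakPoint_pos (breakIndex j)
    have hlt' : breakPoint (breakIndex j) < breakPoint (breakIndex j) / ρ := by
      rw [lt_div_iff₀ hρ0]; nlinarith
    have := Mtilde_strictMonoOn hp.le (hp.le.trans hlt'.le) hlt'
    have hF : (0 : ℝ) < (((breakIndex j + 1)! : ℕ) : ℝ) * (((breakIndex j + 2)! : ℕ) : ℝ) := by
      have := (breakIndex j + 1).factorial_pos
      have := (breakIndex j + 2).factorial_pos
      positivity
    exact absurd hρ (not_le.2 (mul_lt_mul_of_pos_left this hF))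

theorem eLpNorm_two_count_sq (x : ℕ → ℝ) :
    MeasureTheory.eLpNorm x 2 MeasureTheory.Measure.count ^ 2 =
      ∑' n, ENNReal.ofReal (x n ^ 2) := by
  rw [eLpNorm_two_count, ← ENNReal.rpow_natCast, ← ENNReal.rpow_mul]
  norm_num

/-- On row j the difference is N⁻⁴ and the test value is at least a/2; over 1/(ab) places this gives
N⁻⁸ (a/b)/4 = 1/4. -/
theorem one_fourth_le_sq_nrm {A B : Set ℕ} {j : ℕ} (hA : j ∈ A) (hB : j ∉ B) :
    ENNReal.ofReal (1 / 4) ≤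
      (SeqSpace.ell 2).nrm ((selectedSeq A - selectedSeq B) * testSeq j) ^ 2 := by
  change _ ≤ MeasureTheory.eLpNorm _ 2 MeasureTheory.Measure.count ^ 2
  rw [eLpNorm_two_count_sq]
  refine le_trans ?_
    (ENNReal.sum_le_tsum (rowBlock j ((breakIndex j + 1)! * (breakIndex j + 2)!)))
  have hA' := invFact_pos (breakIndex j + 1)
  have hsum : ∑ n ∈ rowBlock j ((breakIndex j + 1)! * (breakIndex j + 2)!),
      ENNReal.ofReal ((((2 ^ (j + 1)) ^ 4)⁻¹ * (invFact (breakIndex j + 1) / 2)) ^ 2) ≤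
      ∑ n ∈ rowBlock j ((breakIndex j + 1)! * (breakIndex j + 2)!),
        ENNReal.ofReal (((selectedSeq A - selectedSeq B) * testSeq j) n ^ 2) := by
    refine Finset.sum_le_sum fun n hn => ENNReal.ofReal_le_ofReal ?_
    have hn' := unpair_of_mem_rowBlock hn
    have h := half_invFact_le_breakPoint (breakIndex j)
    simp only [Pi.mul_apply, Pi.sub_apply, selectedSeq, blockSeq, selectedRow, hn', hA, hB, if_true,
      if_false, hn, testSeq, Finset.notMem_empty, sub_zero]
    gcongr
  refine le_trans ?_ hsum
  rw [sum_ofReal_const, card_rowBlock]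
  refine ENNReal.ofReal_le_ofReal (le_of_eq ?_)
  push_cast
  have e := factorial_breakIndex j
  have f := invFact_mul_factorial (breakIndex j + 1)
  have hN0 : (2 : ℝ) ^ (j + 1) ≠ 0 := by positivity
  generalize (2 : ℝ) ^ (j + 1) = N at *
  generalize invFact (breakIndex j + 1) = B at *
  generalize (((breakIndex j + 1)! : ℕ) : ℝ) = F at *
  rw [e]
  calc (1 / 4 : ℝ) = (B * F) ^ 2 / 4 := by rw [f]; norm_num
    _ = _ := by field_simp; norm_num

theorem not_isSeparable_multipliers :
    ¬ (SeqSpace.multipliers (SeqSpace.orlicz Mtilde) (SeqSpace.ell 2)).IsSeparable := by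
  rintro ⟨D, hD, -, hdense⟩
  -- Two sets sharing an approximant at distance below 1/8 would be at distance at most 1/4, against
  -- the separation 1/2; so approximation injects the subsets of ℕ into D, contradicting Cantor's
  -- theorem.
  have h8 : (0 : ℝ≥0∞) < ENNReal.ofReal (1 / 8) := by simp
  choose d hdD hd using fun A : Set ℕ => hdense _ (selectedSeq_mem_multipliers A) _ h8
  have hsub : ∀ A B : Set ℕ, d A = d B → A ⊆ B := by
    intro A B hAB j hjA
    by_contra hjB
    have hle : ∀ C, MeasureTheory.eLpNorm ((selectedSeq C - d C) * testSeq j) 2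
        MeasureTheory.Measure.count ≤ ENNReal.ofReal (1 / 8) := fun C =>
      (le_iSup₂ (f := fun (g : ℕ → ℝ) (_ : g ∈ (SeqSpace.orlicz Mtilde).carrier ∧
        (SeqSpace.orlicz Mtilde).nrm g = 1) => (SeqSpace.ell 2).nrm ((selectedSeq C - d C) * g))
        (testSeq j) ⟨testSeq_mem_orlicz j, nrm_testSeq j⟩).trans (hd C).le
    have hsplit : (selectedSeq A - selectedSeq B) * testSeq j =
        (selectedSeq A - d A) * testSeq j - (selectedSeq B - d B) * testSeq j := by
      rw [hAB]; ring
    have hlow := one_fourth_le_sq_nrm hjA hjB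
    have hup : (SeqSpace.ell 2).nrm ((selectedSeq A - selectedSeq B) * testSeq j) ≤
        ENNReal.ofReal (1 / 4) := by
      rw [hsplit]
      refine (MeasureTheory.eLpNorm_sub_le measurable_from_nat.aestronglyMeasurable
        measurable_from_nat.aestronglyMeasurable (by norm_num)).trans ?_
      refine (add_le_add (hle A) (hle B)).trans_eq ?_
      rw [← ENNReal.ofReal_add (by norm_num) (by norm_num)]
      norm_num
    have hcontra := hlow.trans (pow_le_pow_left' hup 2)
    rw [← ENNReal.ofReal_pow (by norm_num), ENNReal.ofReal_le_ofReal_iff (by norm_num)] at hcontra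
    norm_num at hcontra
  have hinj : Function.Injective fun A : Set ℕ => (⟨d A, hdD A⟩ : D) := by
    intro A B h
    have hAB : d A = d B := congrArg Subtype.val h
    exact (hsub A B hAB).antisymm (hsub B A hAB.symm)
  have := hD.to_subtype
  obtain ⟨e, he⟩ := exists_injective_nat D
  exact Function.cantor_injective _ (he.comp hinj)

theorem pointwiseProduct_ne_ell_two :
    (SeqSpace.pointwiseProduct (SeqSpace.orlicz Mtilde)
      (SeqSpace.multipliers (SeqSpace.orlicz Mtilde) (SeqSpace.ell 2))).carrier ≠
        (SeqSpace.ell 2).carrier :=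
  fun h => wideSeq_notMem_pointwiseProduct (h ▸ wideSeq_mem_ell_two)

theorem mainTheorem12 :
    IsOrliczFunction Mtilde ∧
    ((SeqSpace.pointwiseProduct (SeqSpace.orlicz Mtilde)
        (SeqSpace.multipliers (SeqSpace.orlicz Mtilde) (SeqSpace.ell 2))).carrier ≠
          (SeqSpace.ell 2).carrier ∧
      ¬ (SeqSpace.pointwiseProduct (SeqSpace.orlicz Mtilde)
        (SeqSpace.multipliers (SeqSpace.orlicz Mtilde) (SeqSpace.ell 2))).Same
          (SeqSpace.ell 2)) ∧
    ((SeqSpace.multipliers (SeqSpace.orlicz Mtilde) (SeqSpace.ell 2)).carrier ≠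
          (SeqSpace.ell ⊤).carrier ∧
      ¬ (SeqSpace.multipliers (SeqSpace.orlicz Mtilde) (SeqSpace.ell 2)).Same
          (SeqSpace.ell ⊤)) ∧
    ¬ (SeqSpace.multipliers (SeqSpace.orlicz Mtilde) (SeqSpace.ell 2)).IsSeparable :=
  ⟨Mtilde_isOrliczFunction,
    ⟨pointwiseProduct_ne_ell_two, fun h => pointwiseProduct_ne_ell_two h.1⟩,
    ⟨multipliers_ne_ell_top, fun h => multipliers_ne_ell_top h.1⟩,
    not_isSeparable_multipliers⟩
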